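/- Let $p$ be a prime and $n\ge 2$ an integer. For a monic polynomial $f\in\mathbb{Z}_p[x]$ of degree $n$, an order in the $\mathbb{Q}_p$-algebra $\mathbb{Q}_p[x]/(f)$ is a subring containing $\mathbb{Z}_p$ that is free of rank $n$ as a $\mathbb{Z}_p$-module; the maximal order is the order containing all others (if there is one). View $\mathbb{Z}_p[x]/(f)$ as a subring of $\mathbb{Q}_p[x]/(f)$. Then the density of monic polynomials $f$ of degree $n$ such that $\mathbb{Z}_p[x]/(f)$ is the maximal order in $\mathbb{Q}_p[x]/(f)$ exists and equals $1-p^{-2}$, in both of the following senses. (i) Identify the monic polynomials of degree $n$ over $\mathbb{Z}_p$ with $\mathbb{Z}_p^n$ through their coefficients. The set of $f\in\mathbb{Z}_p[x]$ with this property is measurable, and its measure for the Haar measure on $\mathbb{Z}_p^n$ of total mass $1$ is $1-p^{-2}$. (ii) Order monic integer polynomials by the height $H(f)$, the maximum of the absolute values of the coefficients of $f$. Then $$\lim_{H\to\infty}\frac{\#\{f\in\mathbb{Z}[x] \text{ monic},\ \deg f=n,\ H(f)\le H,\ \mathbb{Z}_p[x]/(f)\text{ is the maximal order in }\mathbb{Q}_p[x]/(f)\}}{\#\{f\in\mathbb{Z}[x]\text{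 monic},\ \deg f=n,\ H(f)\le H\}}=1-p^{-2}.$$ Moreover, let a degree $d(p)$ be given for every prime $p$, with $d(p)\ge 2$ for all sufficiently large $p$. Then the density, in either sense, of the monic polynomials $f$ of degree $d(p)$ with the above property tends to $1$ as $p\to\infty$. In particular, for every fixed integer $\ell\ge 1$, all of this holds for the degrees $p^{2\ell}$ (with $p\ge 3$) and $(p-1)^{2\ell}$ (with $p\ge 5$). -/

import Mathlib

open Polynomial MeasureTheory Filter Topology

namespace PadicMaximalOrder

/-- A `ℤ_p`-order in a `ℚ_p`-algebra `A`: a subring containing `ℤ_p` that is a free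
`ℤ_p`-module of rank `dim_{ℚ_p} A`. -/
def IsOrder (p : ℕ) [Fact p.Prime] {A : Type*} [CommRing A] [Algebra ℚ_[p] A]
    [Algebra ℤ_[p] A] (R : Subalgebra ℤ_[p] A) : Prop :=
  Module.Free ℤ_[p] R ∧ Module.Finite ℤ_[p] R ∧
    Module.finrank ℤ_[p] R = Module.finrank ℚ_[p] A

/-- `R` is the maximal order of `A`: it is an order and it contains every order. In a
non-reduced algebra, where no such order exists, the predicate is false for all `R`. -/
def IsTheMaximalOrder (p : ℕ) [Fact p.Prime] {A : Type*} [CommRing A] [Algebra ℚ_[p] A]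
    [Algebra ℤ_[p] A] (R : Subalgebra ℤ_[p] A) : Prop :=
  IsGreatest {S : Subalgebra ℤ_[p] A | IsOrder p S} R

/-- The canonical map `ℤ_p[x]/(f) → ℚ_p[x]/(f)` (it is injective when `f` is monic). -/
noncomputable def toGeneric (p : ℕ) [Fact p.Prime] (f : ℤ_[p][X]) :
    AdjoinRoot f →ₐ[ℤ_[p]] AdjoinRoot (f.map (algebraMap ℤ_[p] ℚ_[p])) :=
  AdjoinRoot.mapAlgHom (Algebra.ofId ℤ_[p] ℚ_[p]) f (f.map (algebraMap ℤ_[p] ℚ_[p]))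
    dvd_rfl

/-- `ℤ_p[x]/(f)`, as a subring of `ℚ_p[x]/(f)`, is the maximal order of `ℚ_p[x]/(f)`. -/
def IsMaximalAt (p : ℕ) [Fact p.Prime] (f : ℤ_[p][X]) : Prop :=
  IsTheMaximalOrder p (toGeneric p f).range

/-- The monic polynomial `x ^ n + a_{n-1} x ^ (n-1) + ⋯ + a_0`. -/
noncomputable def monicOfCoeffs {R : Type*} [CommRing R] {n : ℕ} (a : Fin n → R) : R[X] :=
  X ^ n + ∑ i : Fin n, C (a i) * X ^ (i : ℕ)

/-- The monic `f ∈ ℤ_p[x]` of degree `n` for which `ℤ_p[x]/(f)` is the maximal order of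
`ℚ_p[x]/(f)`, as a subset of the space `ℤ_p ^ n` of coefficient vectors. -/
def maximalSet (p : ℕ) [Fact p.Prime] (n : ℕ) : Set (Fin n → ℤ_[p]) :=
  {a | IsMaximalAt p (monicOfCoeffs a)}

noncomputable instance instMeasurableSpacePadicInt (p : ℕ) [Fact p.Prime] :
    MeasurableSpace ℤ_[p] := borel ℤ_[p]

instance instBorelSpacePadicInt (p : ℕ) [Fact p.Prime] : BorelSpace ℤ_[p] := ⟨rfl⟩

/-- The Haar measure on the additive group `ℤ_p ^ n`, normalized to have total mass one. -/
noncomputable def coeffHaar (p : ℕ) [Fact p.Prime] (n : ℕ) : Measure (Fin n → ℤ_[p]) :=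
  Measure.addHaarMeasure ⊤

/-- The `p`-adic density `δ` of a set of monic polynomials of degree `n` over `ℤ_p` (given by
coefficient vectors): the density exists if the set is measurable, and is its Haar measure. -/
def HasPadicDensity (p : ℕ) [Fact p.Prime] {n : ℕ} (S : Set (Fin n → ℤ_[p])) (δ : ℝ) : Prop :=
  MeasurableSet S ∧ (coeffHaar p n).real S = δ

/-- The height of an integer polynomial: the maximum of the absolute values of its
coefficients. -/
def height (f : ℤ[X]) : ℕ := f.support.sup fun i => (f.coeff i).natAbs

/-- The monic integer polynomials of degree `n` and height at most `H` (a finite set). -/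
def heightBox (n H : ℕ) : Set ℤ[X] := {f | f.Monic ∧ f.natDegree = n ∧ height f ≤ H}

/-- Ordered by height, the monic integer polynomials of degree `n` that satisfy `P` have
density `δ`. -/
def HasHeightDensity (n : ℕ) (P : ℤ[X] → Prop) (δ : ℝ) : Prop :=
  Tendsto (fun H : ℕ => ({f ∈ heightBox n H | P f}.ncard : ℝ) / ((heightBox n H).ncard : ℝ))
    atTop (𝓝 δ)

instance instFactPrimes (p : Nat.Primes) : Fact (p : ℕ).Prime := ⟨p.2⟩

/-- The filter on the set of primes that describes `p → ∞`. -/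
def primesAtTop : Filter Nat.Primes := comap (fun p : Nat.Primes => (p : ℕ)) atTop

end PadicMaximalOrder

/-! The argument is Dedekind's criterion followed by a count over the residue field. For monic `f`,
the ring `R = ℤ_p[x]/(f)` is the maximal order iff `f` lies in no `(p, G)²`, with `G` monic and
irreducible mod `p` (`isMaximalAt_iff`). As `p²` lies in each of these ideals, only `f` mod `p²`
matters, so both densities equal the proportion of good residues in `(ZMod (p²))ⁿ`.

To count these, a lift `σ` of each `f̄` is chosen that already lies in `(p, G)²` whenever `ḡ² ∣ f̄`,
where `ḡ` is `G` mod `p`. Then `σ + pH` is bad iff some irreducible `ḡ` has `ḡ² ∣ f̄` and `ḡ ∣ H̄`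
(`exists_lift_memSqMaximal_iff`). So good residues correspond to pairs `(f̄, h)` with `f̄` monic of
degree `n`, `deg h < n`, and no such common `ḡ`.

Every pair is uniquely `(d² f₀, d h₀)` with `d` monic and `(f₀, h₀)` good. If `N n` is the number of
good pairs and `q = p`, this gives `∑ q^(2k) N(n - 2k) = q^(2n)`. Subtracting `q²` times the
identity for `n - 2` leaves `N n = q^(2n) - q^(2n-2)`, a proportion `1 - q⁻²`. -/

namespace PadicMaximalOrder

/-! ### Monic polynomials and their coefficient vectors -/

section MonicOfCoeffs

variable {R : Type*} [CommRing R] {n : ℕ}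

theorem monicOfCoeffs_monic (a : Fin n → R) : (monicOfCoeffs a).Monic :=
  monic_X_pow_add (degree_sum_fin_lt a)

theorem natDegree_monicOfCoeffs [Nontrivial R] (a : Fin n → R) :
    (monicOfCoeffs a).natDegree = n := by
  unfold monicOfCoeffs
  rw [natDegree_add_eq_left_of_degree_lt, natDegree_X_pow]
  rw [degree_X_pow]
  exact degree_sum_fin_lt a

theorem coeff_sum_fin (a : Fin n → R) (i : Fin n) :
    (∑ j : Fin n, C (a j) * X ^ (j : ℕ)).coeff i = a i := by
  simp [coeff_X_pow, Fin.val_inj]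

theorem coeff_monicOfCoeffs (a : Fin n → R) (i : Fin n) : (monicOfCoeffs a).coeff i = a i := by
  unfold monicOfCoeffs
  rw [coeff_add, coeff_sum_fin, coeff_X_pow, if_neg i.2.ne, zero_add]

theorem monicOfCoeffs_injective : Function.Injective (monicOfCoeffs : (Fin n → R) → R[X]) := by
  intro a b h
  ext i
  rw [← coeff_monicOfCoeffs a, h, coeff_monicOfCoeffs]

theorem monicOfCoeffs_coeff {f : R[X]} (hf : f.Monic) (hn : f.natDegree = n) :
    monicOfCoeffs (fun i : Fin n => f.coeff i) = f := by
  conv_rhs => rw [hf.as_sum, hn]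
  rw [monicOfCoeffs, Fin.sum_univ_eq_sum_range (fun i => C (f.coeff i) * X ^ i)]

theorem map_monicOfCoeffs {S : Type*} [CommRing S] (φ : R →+* S) (a : Fin n → R) :
    (monicOfCoeffs a).map φ = monicOfCoeffs (fun i => φ (a i)) := by
  simp [monicOfCoeffs, Polynomial.map_sum]

/-- The monic polynomials of degree `n`. -/
def monicsOfDegree (R : Type*) [CommRing R] (n : ℕ) : Set R[X] := {f | f.Monic ∧ f.natDegree = n}

/-- Monic polynomials of degree `n` correspond to their coefficient vectors. -/
noncomputable def equivMonicsOfDegree (R : Type*) [CommRing R] [Nontrivial R] (n : ℕ) :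
    (Fin n → R) ≃ monicsOfDegree R n :=
  Equiv.ofBijective (fun a => ⟨monicOfCoeffs a, monicOfCoeffs_monic a, natDegree_monicOfCoeffs a⟩)
    ⟨fun _ _ h => monicOfCoeffs_injective (Subtype.ext_iff.1 h),
      fun f => ⟨_, Subtype.ext (monicOfCoeffs_coeff f.2.1 f.2.2)⟩⟩

end MonicOfCoeffs

/-! ### Counting pairs without a common square over a finite field -/

section Counting

variable {F : Type*} [Field F]

/-- No nonunit `g` satisfies both `g ^ 2 ∣ f` and `g ∣ h`. -/
def NoCommonSquare (f h : F[X]) : Prop := ∀ g, g ^ 2 ∣ f → g ∣ h → IsUnit g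

/-- The pairs of a monic polynomial `f` of degree `m` and a polynomial `h` of degree less than
`l` such that `NoCommonSquare f h`. -/
def goodPairs (F : Type*) [Field F] (m l : ℕ) : Set (F[X] × F[X]) :=
  {x | (x.1.Monic ∧ x.1.natDegree = m) ∧ x.2 ∈ degreeLT F l ∧ NoCommonSquare x.1 x.2}

instance finite_degreeLT [Finite F] (l : ℕ) : Finite (degreeLT F l) :=
  Finite.of_equiv _ (degreeLTEquiv F l).toEquiv.symm

instance finite_monicsOfDegree [Finite F] (n : ℕ) : Finite (monicsOfDegree F n) :=
  Finite.of_equiv _ (equivMonicsOfDegree F n)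

instance finite_goodPairs [Finite F] (m l : ℕ) : Finite (goodPairs F m l) :=
  Finite.of_injective
    (fun x : goodPairs F m l =>
      ((⟨x.1.1, x.2.1⟩, ⟨x.1.2, x.2.2.1⟩) : monicsOfDegree F m × degreeLT F l))
    (fun x y h => by
      rw [Prod.ext_iff, Subtype.ext_iff, Subtype.ext_iff] at h
      exact Subtype.ext (Prod.ext h.1 h.2))

theorem card_degreeLT [Finite F] (l : ℕ) : Nat.card (degreeLT F l) = Nat.card F ^ l := by
  rw [Nat.card_congr (degreeLTEquiv F l).toEquiv, Nat.card_fun, Nat.card_fin]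

theorem card_monicsOfDegree [Finite F] (n : ℕ) :
    Nat.card (monicsOfDegree F n) = Nat.card F ^ n := by
  rw [← Nat.card_congr (equivMonicsOfDegree F n), Nat.card_fun, Nat.card_fin]

theorem noCommonSquare_add_mul {f h r : F[X]} :
    NoCommonSquare f (h + f * r) ↔ NoCommonSquare f h := by
  refine forall_congr' fun g => imp_congr_right fun hg => ?_
  have : g ∣ f * r := ((dvd_pow_self g two_ne_zero).trans hg).mul_right r
  rw [dvd_add_left this]

/-- The condition depends on `h` only modulo `f`, so division by `f` leaves a remainder that carries
the condition and a free quotient of degree less than `k`. -/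
theorem card_goodPairs_add [Finite F] (m k : ℕ) :
    Nat.card (goodPairs F m (m + k)) = Nat.card F ^ k * Nat.card (goodPairs F m m) := by
  rw [← card_degreeLT, ← Nat.card_prod]
  symm
  have key : ∀ {f h r : F[X]}, f.Monic → f.natDegree = m → h ∈ degreeLT F m →
      r ∈ degreeLT F k → h + f * r ∈ degreeLT F (m + k) := by
    intro f h r hf hm hh hr
    rw [mem_degreeLT] at *
    refine (degree_add_le _ _).trans_lt (max_lt (hh.trans_le (by norm_cast; omega)) ?_)
    rcases eq_or_ne r 0 with rfl | hr0
    · simp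
    rw [degree_mul, degree_eq_natDegree hf.ne_zero, hm, degree_eq_natDegree hr0]
    rw [degree_eq_natDegree hr0] at hr
    norm_cast at *
    omega
  refine Nat.card_congr (Equiv.ofBijective (fun x : degreeLT F k × goodPairs F m m =>
    (⟨(x.2.1.1, x.2.1.2 + x.2.1.1 * x.1.1), x.2.2.1, key x.2.2.1.1 x.2.2.1.2 x.2.2.2.1 x.1.2,
      noCommonSquare_add_mul.2 x.2.2.2.2⟩ : goodPairs F m (m + k))) ⟨?_, ?_⟩)
  · rintro ⟨⟨r, hr⟩, ⟨⟨f, h⟩, ⟨hf, hm⟩, hh, hg⟩⟩ ⟨⟨r', hr'⟩, ⟨⟨f', h'⟩, ⟨hf', hm'⟩, hh', hg'⟩⟩ he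
    rw [Subtype.ext_iff, Prod.ext_iff] at he
    dsimp only at *
    obtain ⟨rfl, he⟩ := he
    have hd : ∀ {h : F[X]}, h ∈ degreeLT F m → h.degree < f.degree := fun hh => by
      rw [mem_degreeLT] at hh
      rwa [degree_eq_natDegree hf.ne_zero, hm]
    obtain ⟨h1, h2⟩ := div_modByMonic_unique r h hf ⟨rfl, hd hh⟩
    obtain ⟨h3, h4⟩ := div_modByMonic_unique r' h' hf ⟨rfl, hd hh'⟩
    have e1 : r = r' := by rw [← h1, ← h3, he]
    have e2 : h = h' := by rw [← h2, ← h4, he]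
    subst e1 e2
    rfl
  · rintro ⟨⟨f, h⟩, ⟨hf, hm⟩, hh, hg⟩
    dsimp only at *
    have e : h %ₘ f + f * (h /ₘ f) = h := modByMonic_add_div h f
    refine ⟨⟨⟨h /ₘ f, ?_⟩, ⟨(f, h %ₘ f), ⟨hf, hm⟩, ?_, ?_⟩⟩, ?_⟩
    · rw [mem_degreeLT] at *
      rcases eq_or_ne (h /ₘ f) 0 with h0 | h0
      · simp [h0]
      have hfh : f.degree ≤ h.degree := by
        by_contra hlt
        exact h0 ((divByMonic_eq_zero_iff hf).2 (not_le.1 hlt))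
      have h1 := degree_add_divByMonic hf hfh
      have hne : h ≠ 0 := by rintro rfl; simp at h0
      rw [degree_eq_natDegree hne, degree_eq_natDegree h0, degree_eq_natDegree hf.ne_zero, hm] at h1
      rw [degree_eq_natDegree hne] at hh
      rw [degree_eq_natDegree h0]
      norm_cast at *
      omega
    · rw [mem_degreeLT, ← hm, ← degree_eq_natDegree hf.ne_zero]
      exact degree_modByMonic_lt h hf
    · rw [← e] at hg
      exact noCommonSquare_add_mul.1 hg
    · simp only [e]

theorem mul_mem_degreeLT_iff {d h : F[X]} {k l : ℕ} (hd : d.Monic) (hk : d.natDegree = k)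
    (hkl : k ≤ l) : d * h ∈ degreeLT F l ↔ h ∈ degreeLT F (l - k) := by
  rw [mem_degreeLT, mem_degreeLT]
  rcases eq_or_ne h 0 with rfl | h0
  · simp
  rw [degree_mul, degree_eq_natDegree hd.ne_zero, degree_eq_natDegree h0, hk]
  norm_cast
  omega

/-- Once the common factor of `d` and `e` is cancelled, what remains of `e` has its square dividing
`f₀` and itself divides `h₀`, so it is a unit. Used in both directions, this makes the extracted
factor unique. -/
theorem NoCommonSquare.dvd_of_mul_eq {f₀ f₁ h₀ h₁ d e : F[X]} (hd : d ≠ 0)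
    (hf : d ^ 2 * f₀ = e ^ 2 * f₁) (hh : d * h₀ = e * h₁) (hg : NoCommonSquare f₀ h₀) :
    e ∣ d := by
  obtain ⟨d', e', c, hcop, rfl, rfl⟩ := UniqueFactorizationMonoid.exists_reduced_factors d hd e
  have hc : c ≠ 0 := left_ne_zero_of_mul hd
  have hf' : d' ^ 2 * f₀ = e' ^ 2 * f₁ :=
    mul_left_cancel₀ (pow_ne_zero 2 hc) (by linear_combination hf)
  have hh' : d' * h₀ = e' * h₁ := mul_left_cancel₀ hc (by linear_combination hh)
  have hu : IsUnit e' := hg e'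
    ((hcop.symm.pow (m := 2) (n := 2)).dvd_of_dvd_mul_left ⟨f₁, hf'⟩)
    (hcop.symm.dvd_of_dvd_mul_left ⟨h₁, hh'⟩)
  exact (hu.mul_right_dvd.2 dvd_rfl : c * e' ∣ c).trans (dvd_mul_right _ _)

theorem exists_mul_noCommonSquare {f h : F[X]} (hf : f.Monic) :
    ∃ d f₀ h₀ : F[X], d.Monic ∧ f₀.Monic ∧ f = d ^ 2 * f₀ ∧ h = d * h₀ ∧
      NoCommonSquare f₀ h₀ := by
  classical
  induction hn : f.natDegree using Nat.strong_induction_on generalizing f h with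
  | _ n ih =>
    by_cases hg : NoCommonSquare f h
    · exact ⟨1, f, h, monic_one, hf, by simp, by simp, hg⟩
    · simp only [NoCommonSquare, not_forall] at hg
      obtain ⟨g, hgf, hgh, hgu⟩ := hg
      have hg0 : g ≠ 0 := by
        rintro rfl
        exact hf.ne_zero (by simpa using hgf)
      have hnm : (normalize g).Monic := monic_normalize hg0
      obtain ⟨f', rfl⟩ : normalize g ^ 2 ∣ f := ((normalize_associated g).pow_pow).dvd.trans hgf
      obtain ⟨h', rfl⟩ : normalize g ∣ h := normalize_dvd_iff.2 hgh
      have hf' : f'.Monic := (hnm.pow 2).of_mul_monic_left hf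
      have hpos : 0 < (normalize g).natDegree :=
        hnm.natDegree_pos_of_not_isUnit fun hu => hgu ((normalize_associated g).isUnit hu)
      obtain ⟨d, f₀, h₀, hd, hf₀, rfl, rfl, hgood⟩ := ih f'.natDegree
        (by rw [← hn, (hnm.pow 2).natDegree_mul hf', hnm.natDegree_pow]; omega) (h := h') hf' rfl
      exact ⟨normalize g * d, f₀, h₀, hnm.mul hd, hf₀, by ring, by ring, hgood⟩

/-- All pairs `(f, h)` are sorted by the degree `k` of the monic factor `d` in `f = d² f₀`, `h = d
h₀`. There are `q^k` choices of `d`, and another `q^k` arises because `h₀` ranges over degree below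
`n - k` rather than `n - 2k`. -/
theorem sum_card_goodPairs [Finite F] (n : ℕ) :
    ∑ k ∈ Finset.range (n / 2 + 1),
      Nat.card F ^ (2 * k) * Nat.card (goodPairs F (n - 2 * k) (n - 2 * k)) =
      Nat.card F ^ (2 * n) := by
  have e1 : ∀ k ∈ Finset.range (n / 2 + 1),
      Nat.card F ^ (2 * k) * Nat.card (goodPairs F (n - 2 * k) (n - 2 * k)) =
        Nat.card (monicsOfDegree F k × goodPairs F (n - 2 * k) (n - k)) := by
    intro k hk
    have hk' : n - k = n - 2 * k + k := by
      have := Finset.mem_range.1 hk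
      omega
    rw [Nat.card_prod, card_monicsOfDegree, hk', card_goodPairs_add]
    ring
  rw [Finset.sum_congr rfl e1, Finset.sum_range
    (fun k => Nat.card (monicsOfDegree F k × goodPairs F (n - 2 * k) (n - k))),
    ← Nat.card_sigma, two_mul, pow_add]
  nth_rw 1 [← card_monicsOfDegree]
  rw [← card_degreeLT, ← Nat.card_prod]
  refine Nat.card_congr (Equiv.ofBijective
    (fun x : (k : Fin (n / 2 + 1)) ×
        (monicsOfDegree F k × goodPairs F (n - 2 * k) (n - k)) =>
      ((⟨x.2.1.1 ^ 2 * x.2.2.1.1, (x.2.1.2.1.pow 2).mul x.2.2.2.1.1, ?_⟩,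
        ⟨x.2.1.1 * x.2.2.1.2, ?_⟩) : monicsOfDegree F n × degreeLT F n)) ⟨?_, ?_⟩)
  · obtain ⟨⟨k, hk⟩, ⟨d, hd, hdk⟩, ⟨⟨f, h⟩, ⟨hf, hm⟩, hh, hg⟩⟩ := x
    dsimp only at *
    rw [(hd.pow 2).natDegree_mul hf, hd.natDegree_pow, hm, hdk]
    omega
  · obtain ⟨⟨k, hk⟩, ⟨d, hd, hdk⟩, ⟨⟨f, h⟩, ⟨hf, hm⟩, hh, hg⟩⟩ := x
    exact (mul_mem_degreeLT_iff hd hdk (by dsimp only; omega)).2 hh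
  · rintro ⟨⟨k, hk⟩, ⟨d, hd, hdk⟩, ⟨⟨f, h⟩, ⟨hf, hm⟩, hh, hg⟩⟩
      ⟨⟨k', hk'⟩, ⟨d', hd', hdk'⟩, ⟨⟨f', h'⟩, ⟨hf', hm'⟩, hh', hg'⟩⟩ he
    rw [Prod.ext_iff, Subtype.ext_iff, Subtype.ext_iff] at he
    dsimp only at *
    obtain ⟨he1, he2⟩ := he
    have h1 : d = d' := eq_of_monic_of_associated hd hd' (associated_of_dvd_dvd
      (hg'.dvd_of_mul_eq hd'.ne_zero he1.symm he2.symm) (hg.dvd_of_mul_eq hd.ne_zero he1 he2))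
    subst h1
    have h2 : k = k' := hdk.symm.trans hdk'
    subst h2
    have h3 : f = f' := mul_left_cancel₀ (pow_ne_zero 2 hd.ne_zero) he1
    have h4 : h = h' := mul_left_cancel₀ hd.ne_zero he2
    subst h3 h4
    rfl
  · rintro ⟨⟨f, hf, hfn⟩, ⟨h, hh⟩⟩
    obtain ⟨d, f₀, h₀, hd, hf₀, rfl, rfl, hg⟩ := exists_mul_noCommonSquare (h := h) hf
    rw [(hd.pow 2).natDegree_mul hf₀, hd.natDegree_pow] at hfn
    refine ⟨⟨⟨d.natDegree, by omega⟩, ⟨d, hd, rfl⟩, ⟨(f₀, h₀), ⟨hf₀, ?_⟩, ?_, hg⟩⟩, rfl⟩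
    · dsimp only
      omega
    · exact (mul_mem_degreeLT_iff hd rfl (by omega)).1 hh

theorem card_goodPairs [Finite F] {n : ℕ} (hn : 2 ≤ n) :
    Nat.card (goodPairs F n n) + Nat.card F ^ (2 * n - 2) = Nat.card F ^ (2 * n) := by
  obtain ⟨m, rfl⟩ := Nat.exists_eq_add_of_le' hn
  have h := sum_card_goodPairs (F := F) (m + 2)
  -- The term `k = 0` is the wanted cardinality; the others form `q²` times the same sum for `m`.
  rw [Finset.sum_range_succ', show (m + 2) / 2 = m / 2 + 1 by omega] at h
  have e : ∀ k ∈ Finset.range (m / 2 + 1), Nat.card F ^ (2 * (k + 1)) *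
      Nat.card (goodPairs F (m + 2 - 2 * (k + 1)) (m + 2 - 2 * (k + 1))) =
      Nat.card F ^ 2 * (Nat.card F ^ (2 * k) *
        Nat.card (goodPairs F (m - 2 * k) (m - 2 * k))) := by
    intro k hk
    rw [show m + 2 - 2 * (k + 1) = m - 2 * k by omega]
    ring
  rw [Finset.sum_congr rfl e, ← Finset.mul_sum, sum_card_goodPairs] at h
  simp only [mul_zero, pow_zero, one_mul, Nat.sub_zero] at h
  rw [← h, show 2 * (m + 2) - 2 = 2 * m + 2 by omega]
  ring

end Counting

/-! ### Reduction modulo `p` and squares of maximal ideals -/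

section Reduction

variable {p : ℕ} [Fact p.Prime]

/-- Reduction of polynomials modulo `p`. -/
noncomputable abbrev red (p : ℕ) [Fact p.Prime] : ℤ_[p][X] →+* (ZMod p)[X] :=
  mapRingHom PadicInt.toZMod

theorem toZMod_surjective : Function.Surjective (PadicInt.toZMod (p := p)) :=
  ZMod.ringHom_surjective _

theorem red_surjective : Function.Surjective (red p) :=
  map_surjective _ toZMod_surjective

@[simp]
theorem red_natCast_self : red p (p : ℤ_[p][X]) = 0 := by
  rw [map_natCast, CharP.cast_eq_zero]

theorem natCast_self_ne_zero : (p : ℤ_[p][X]) ≠ 0 := by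
  exact_mod_cast (Fact.out : p.Prime).ne_zero

theorem exists_eq_of_red_eq_zero {P : ℤ_[p][X]} (h : red p P = 0) :
    ∃ E, P = (p : ℤ_[p][X]) * E := by
  change (p : ℤ_[p][X]) ∣ P
  rw [← C_eq_natCast, C_dvd_iff_dvd_coeff]
  intro i
  rw [← Ideal.mem_span_singleton, ← PadicInt.maximalIdeal_eq_span_p, ← PadicInt.ker_toZMod,
    RingHom.mem_ker, ← coeff_map]
  simpa using congrArg (fun Q => Q.coeff i) h

theorem exists_eq_of_red_dvd {G P : ℤ_[p][X]} (h : red p G ∣ red p P) :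
    ∃ U V, P = G * U + (p : ℤ_[p][X]) * V := by
  obtain ⟨u, hu⟩ := h
  obtain ⟨U, rfl⟩ := red_surjective u
  obtain ⟨V, hV⟩ := exists_eq_of_red_eq_zero (P := P - G * U)
    (by rw [map_sub, map_mul, hu, sub_self])
  exact ⟨U, V, by linear_combination hV⟩

theorem exists_monic_lift {g : (ZMod p)[X]} (hg : g.Monic) :
    ∃ G : ℤ_[p][X], red p G = g ∧ G.natDegree = g.natDegree ∧ G.Monic :=
  lifts_and_natDegree_eq_and_monic
    ((mem_lifts _).2 (red_surjective g)) hg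

theorem exists_bezout_lift {G Q : ℤ_[p][X]} (hG : Irreducible (red p G))
    (h : ¬ red p G ∣ red p Q) : ∃ A B E, A * Q = 1 + G * B + (p : ℤ_[p][X]) * E := by
  obtain ⟨a, b, hab⟩ := (hG.coprime_iff_not_dvd (n := red p Q)).2 h
  obtain ⟨A, rfl⟩ := red_surjective a
  obtain ⟨B, rfl⟩ := red_surjective b
  obtain ⟨E, hE⟩ := exists_eq_of_red_eq_zero (P := A * G + B * Q - 1)
    (by rw [map_sub, map_add, map_mul, map_mul, hab, map_one, sub_self])
  exact ⟨B, -A, E, by linear_combination hE⟩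

/-- `f` lies in the square of a maximal ideal `(p, G)` of `ℤ_p[x]`. -/
def MemSqMaximal (f : ℤ_[p][X]) : Prop :=
  ∃ G a b c : ℤ_[p][X], G.Monic ∧ Irreducible (red p G) ∧
    f = G ^ 2 * c + (p : ℤ_[p][X]) * G * b + (p : ℤ_[p][X]) ^ 2 * a

/-- Since `q` is invertible modulo `m = (p, G)`, some `A` satisfies `A q = 1 + ε` with `ε ∈ m`. Then
`f = A (1 - ε) (f q) + ε² f` lies in `m²`. -/
theorem MemSqMaximal.of_mul {f G q a b c : ℤ_[p][X]} (hG : G.Monic)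
    (hirr : Irreducible (red p G)) (hq : ¬ red p G ∣ red p q)
    (h : f * q = G ^ 2 * c + (p : ℤ_[p][X]) * G * b + (p : ℤ_[p][X]) ^ 2 * a) :
    MemSqMaximal f := by
  obtain ⟨A, B, E, hA⟩ := exists_bezout_lift hirr hq
  refine ⟨G, A * a * (1 - (G * B + p * E)) + f * E ^ 2,
    A * b * (1 - (G * B + p * E)) + 2 * f * B * E,
    A * c * (1 - (G * B + p * E)) + f * B ^ 2, hG, hirr, ?_⟩
  linear_combination (A * (1 - (G * B + p * E))) * h - f * (1 - (G * B + p * E)) * hA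

theorem MemSqMaximal.add {f : ℤ_[p][X]} (hf : MemSqMaximal f) (e : ℤ_[p][X]) :
    MemSqMaximal (f + (p : ℤ_[p][X]) ^ 2 * e) := by
  obtain ⟨G, a, b, c, hG, hirr, rfl⟩ := hf
  exact ⟨G, a + e, b, c, hG, hirr, by ring⟩

end Reduction

/-! ### Dedekind's criterion: outside the squares, the ring is integrally closed -/

section Closed

variable {p : ℕ} [Fact p.Prime]

/-- Write `R` for the image of `φ`. An integral element outside `R` yields a `β` whose conductor
into `R` is a maximal ideal `m = (p, G)`. Integrality forces `m β ⊆ m`, and comparing `G (p β)` with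
`p (G β)` in `ℤ_p[x]` gives `f q ∈ m²` for some `q`. If `q ∉ m` then `f ∈ m²`; if `q ∈ m` then `β ∈
R`. -/
theorem exists_of_isIntegralElem {f : ℤ_[p][X]} (hf : f.Monic) (hbad : ¬ MemSqMaximal f)
    {A : Type*} [CommRing A] (φ : AdjoinRoot f →+* A) (hφ : Function.Injective φ)
    (hp : IsUnit (p : A)) (hden : ∀ x : A, ∃ k : ℕ, (p : A) ^ k * x ∈ φ.range)
    {x : A} (hx : φ.IsIntegralElem x) : x ∈ φ.range := by
  classical
  by_contra hxr
  set ev : ℤ_[p][X] →+* A := φ.comp (AdjoinRoot.mk f) with hev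
  have hevr : ∀ P, ev P ∈ φ.range := fun P => ⟨_, rfl⟩
  have hrange : ∀ y ∈ φ.range, ∃ P, ev P = y := by
    rintro _ ⟨r, rfl⟩
    obtain ⟨P, rfl⟩ := AdjoinRoot.mk_surjective r
    exact ⟨P, rfl⟩
  have hevp : ev (p : ℤ_[p][X]) = (p : A) := map_natCast _ _
  have hker : ∀ P, ev P = 0 ↔ f ∣ P := fun P => by
    rw [hev, RingHom.comp_apply, map_eq_zero_iff φ hφ, AdjoinRoot.mk_eq_zero]
  obtain ⟨n, hn, hmin⟩ : ∃ n : ℕ, (∃ (G : ℤ_[p][X]) (β : A), G.Monic ∧ G.natDegree = n ∧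
      φ.IsIntegralElem β ∧ β ∉ φ.range ∧ (p : A) * β ∈ φ.range ∧ ev G * β ∈ φ.range) ∧
      ∀ m < n, ¬ (∃ (G : ℤ_[p][X]) (β : A), G.Monic ∧ G.natDegree = m ∧
      φ.IsIntegralElem β ∧ β ∉ φ.range ∧ (p : A) * β ∈ φ.range ∧ ev G * β ∈ φ.range) := by
    have hex : ∃ n : ℕ, (∃ (G : ℤ_[p][X]) (β : A), G.Monic ∧ G.natDegree = n ∧
        φ.IsIntegralElem β ∧ β ∉ φ.range ∧ (p : A) * β ∈ φ.range ∧ ev G * β ∈ φ.range) := by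
      -- The last multiple `p ^ k * x` outside `R` serves as `β`, and `G = f` is admissible since
      -- `f` vanishes in `A`.
      have hk := hden x
      obtain ⟨k, hk'⟩ : ∃ k, Nat.find hk = k + 1 := by
        refine Nat.exists_eq_succ_of_ne_zero fun h0 => hxr ?_
        have := Nat.find_spec hk
        rwa [h0, pow_zero, one_mul] at this
      refine ⟨_, f, (p : A) ^ k * x, hf, rfl, ?_, Nat.find_min hk (by omega), ?_, ?_⟩
      · rw [← map_natCast φ, ← map_pow]
        exact (φ.isIntegralElem_map).mul φ hx
      · rw [← mul_assoc, ← pow_succ', ← hk']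
        exact Nat.find_spec hk
      · rw [(hker f).2 dvd_rfl, zero_mul]
        exact zero_mem _
    exact ⟨Nat.find hex, Nat.find_spec hex, fun m hm => Nat.find_min hex hm⟩
  obtain ⟨G, β, hG, rfl, hβ, hβr, hpβ, hGβ⟩ := hn
  have hGred : (red p G).Monic := hG.map _
  have hdeg : (red p G).natDegree = G.natDegree := hG.natDegree_map _
  have hirr : Irreducible (red p G) := by
    rw [hGred.irreducible_iff_natDegree']
    constructor
    · intro h1
      have h0 : G = 1 := hG.natDegree_eq_zero.1 (by rw [← hdeg, h1, natDegree_one])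
      rw [h0, map_one, one_mul] at hGβ
      exact hβr hGβ
    · intro a b ha hb hab hbdeg
      have hsum : a.natDegree + b.natDegree = G.natDegree := by
        rw [← ha.natDegree_mul hb, hab, hdeg]
      rw [Finset.mem_Ioc, hdeg] at hbdeg
      obtain ⟨A', rfl, hA, hAm⟩ := exists_monic_lift ha
      obtain ⟨B', rfl, hB, hBm⟩ := exists_monic_lift hb
      obtain ⟨E, hE⟩ := exists_eq_of_red_eq_zero (P := G - A' * B')
        (by rw [map_sub, map_mul, hab, sub_self])
      -- A factorization of `G` mod `p` contradicts minimality: either `B'` already sends `β` into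
      -- `R`, or `B' β` is a new element outside `R` that `A'` sends into `R`.
      by_cases hBβ : ev B' * β ∈ φ.range
      · exact hmin _ (by omega) ⟨B', β, hBm, hB, hβ, hβr, hpβ, hBβ⟩
      · refine hmin _ (by omega) ⟨A', ev B' * β, hAm, hA, (φ.isIntegralElem_map).mul φ hβ, hBβ,
          ?_, ?_⟩
        · rw [mul_left_comm]
          exact mul_mem (hevr _) hpβ
        · have : ev A' * (ev B' * β) = ev G * β - ev E * ((p : A) * β) := by
            rw [← hevp]
            have := congrArg ev hE
            simp only [map_sub, map_mul] at this
            linear_combination (-β) * this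
          rw [this]
          exact sub_mem hGβ (mul_mem (hevr _) hpβ)
  have hann : ∀ Q, ev Q * β ∈ φ.range → red p G ∣ red p Q := by
    intro Q hQ
    by_contra hnd
    obtain ⟨A', B', E, hA⟩ := exists_bezout_lift hirr hnd
    have : β = ev A' * (ev Q * β) - ev B' * (ev G * β) - ev E * ((p : A) * β) := by
      rw [← hevp]
      have := congrArg ev hA
      simp only [map_add, map_mul, map_one] at this
      linear_combination (-β) * this
    rw [this] at hβr
    exact hβr (sub_mem (sub_mem (mul_mem (hevr _) hQ) (mul_mem (hevr _) hGβ))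
      (mul_mem (hevr _) hpβ))
  have hGf : red p G ∣ red p f := hann f (by
    rw [(hker f).2 dvd_rfl, zero_mul]
    exact zero_mem _)
  -- Clearing denominators in a monic equation for `β = Y / M` gives `M ∣ Y ^ deg P` modulo `f`; now
  -- `M` and `f` lie in the prime ideal `(p, G)`, hence so does `Y`.
  have hmem : ∀ M Y, red p G ∣ red p M → ev M * β = ev Y → red p G ∣ red p Y := by
    intro M Y hM hMY
    obtain ⟨P, hP, hPβ⟩ := hβ
    obtain ⟨z, hz⟩ := dvd_pow_natDegree_of_eval₂_eq_zero hφ hP (AdjoinRoot.mk f M)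
      (AdjoinRoot.mk f Y) β hPβ hMY
    obtain ⟨Z, rfl⟩ := AdjoinRoot.mk_surjective z
    rw [← map_pow, ← map_mul, AdjoinRoot.mk_eq_mk] at hz
    obtain ⟨W, hW⟩ := hz
    refine hirr.prime.dvd_of_dvd_pow (n := P.natDegree) ?_
    rw [← map_pow, show Y ^ P.natDegree = M * Z + f * W by linear_combination hW, map_add,
      map_mul, map_mul]
    exact dvd_add (hM.mul_right _) (hGf.mul_right _)
  obtain ⟨B, hB⟩ := hrange _ hpβ
  obtain ⟨D, hD⟩ := hrange _ hGβ
  obtain ⟨V, U, hBU⟩ := exists_eq_of_red_dvd (hmem p B (by simp) (by rw [hB, hevp]))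
  obtain ⟨Z, W, hDZ⟩ := exists_eq_of_red_dvd (hmem G D dvd_rfl hD.symm)
  obtain ⟨q, hq⟩ : f ∣ G * B - p * D := by
    rw [← hker, map_sub, map_mul, map_mul, hB, hD, hevp]
    ring
  by_cases hGq : red p G ∣ red p q
  · obtain ⟨b, a, rfl⟩ := exists_eq_of_red_dvd hGq
    obtain ⟨E, hE⟩ := exists_eq_of_red_eq_zero (P := B - f * b) (by
      have h1 : G * (B - f * b) = p * (D + f * a) := by linear_combination hq
      have h2 := congrArg (red p) h1
      rw [map_mul, map_mul, red_natCast_self, zero_mul] at h2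
      exact (mul_eq_zero.1 h2).resolve_left hirr.ne_zero)
    have h3 : (p : A) * β = p * ev E := by
      rw [← hB, ← hevp, ← map_mul, ← hE, map_sub, map_mul, (hker f).2 dvd_rfl]
      ring
    exact hβr (hp.mul_left_cancel h3 ▸ hevr E)
  · refine hbad (MemSqMaximal.of_mul (a := -W) (b := U - Z) (c := V) hG hirr hGq ?_)
    rw [← hq, hBU, hDZ]
    ring

end Closed

/-! ### Orders in `ℚ_p[x]/(f)` and the full criterion -/

section Orders

variable {p : ℕ} [Fact p.Prime]

theorem isTorsionFree_of_algebra (p : ℕ) [Fact p.Prime] (A : Type*) [CommRing A] [Algebra ℚ_[p] A]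
    [Algebra ℤ_[p] A] [IsScalarTower ℤ_[p] ℚ_[p] A] : Module.IsTorsionFree ℤ_[p] A :=
  .trans_faithfulSMul ℤ_[p] ℚ_[p] A

theorem isOrder_of_le {A : Type*} [CommRing A] [Algebra ℚ_[p] A] [Module.Finite ℚ_[p] A]
    [Algebra ℤ_[p] A] [IsScalarTower ℤ_[p] ℚ_[p] A] {R S : Subalgebra ℤ_[p] A}
    (hR : Module.finrank ℤ_[p] R = Module.finrank ℚ_[p] A) (hRS : R ≤ S)
    [Module.Finite ℤ_[p] S] : IsOrder p S := by
  have := isTorsionFree_of_algebra p A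
  have hfree : Module.Free ℤ_[p] S := Module.free_of_finite_type_torsion_free'
  refine ⟨hfree, inferInstance, le_antisymm ?_ (hR ▸ ?_)⟩
  · have b := Module.finBasis ℤ_[p] S
    have hli : LinearIndependent ℤ_[p] (fun i => (b i : A)) :=
      b.linearIndependent.map' S.val.toLinearMap
        (LinearMap.ker_eq_bot.2 Subtype.val_injective)
    have h := ((LinearIndependent.iff_fractionRing ℤ_[p] ℚ_[p]).1 hli).fintype_card_le_finrank
    rwa [Fintype.card_fin] at h
  · have : Module.Finite ℤ_[p] (Subalgebra.toSubmodule S) := ‹Module.Finite ℤ_[p] S›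
    exact Submodule.finrank_mono (s := Subalgebra.toSubmodule R) (t := Subalgebra.toSubmodule S) hRS

variable {f : ℤ_[p][X]}

theorem toGeneric_mk (P : ℤ_[p][X]) : toGeneric p f (AdjoinRoot.mk f P) =
    AdjoinRoot.mk _ (P.map (algebraMap ℤ_[p] ℚ_[p])) := by
  have h : eval₂ ((AdjoinRoot.of (f.map (algebraMap ℤ_[p] ℚ_[p]))).comp
      (algebraMap ℤ_[p] ℚ_[p])) (AdjoinRoot.root _) f = 0 := by
    rw [← eval₂_map, AdjoinRoot.eval₂_root]
  refine (AdjoinRoot.lift_mk h P).trans ?_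
  rw [← AdjoinRoot.aeval_eq, aeval_def, eval₂_map]
  rfl

theorem toGeneric_injective (hf : f.Monic) : Function.Injective (toGeneric p f) := by
  rw [injective_iff_map_eq_zero]
  intro x hx
  obtain ⟨P, rfl⟩ := AdjoinRoot.mk_surjective x
  rw [toGeneric_mk, AdjoinRoot.mk_eq_zero,
    map_dvd_map _ (FaithfulSMul.algebraMap_injective _ _) hf] at hx
  exact AdjoinRoot.mk_eq_zero.2 hx

theorem isUnit_natCast_prime (A : Type*) [CommRing A] [Algebra ℚ_[p] A] : IsUnit (p : A) := by
  rw [← map_natCast (algebraMap ℚ_[p] A)]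
  exact (IsUnit.mk0 _ (Nat.cast_ne_zero.2 (Fact.out : p.Prime).ne_zero)).map _

/-- A common denominator in `ℤ_p` is a unit times a power of `p`. -/
theorem exists_pow_mul_mem_range (x : AdjoinRoot (f.map (algebraMap ℤ_[p] ℚ_[p]))) :
    ∃ k : ℕ, (p : AdjoinRoot (f.map (algebraMap ℤ_[p] ℚ_[p]))) ^ k * x ∈
      (toGeneric p f).toRingHom.range := by
  obtain ⟨Q, rfl⟩ := AdjoinRoot.mk_surjective x
  obtain ⟨b, hb, hbQ⟩ := IsLocalization.integerNormalization_spec (nonZeroDivisors ℤ_[p]) Q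
  have hb0 : b ≠ 0 := nonZeroDivisors.ne_zero hb
  have hspec := PadicInt.unitCoeff_spec hb0
  set u := PadicInt.unitCoeff hb0
  set N := IsLocalization.integerNormalization (nonZeroDivisors ℤ_[p]) Q
  refine ⟨b.valuation, AdjoinRoot.mk f (C (↑u⁻¹ : ℤ_[p]) * N), ?_⟩
  change toGeneric p f _ = _
  rw [toGeneric_mk, ← map_natCast (AdjoinRoot.mk (f.map (algebraMap ℤ_[p] ℚ_[p]))), ← map_pow,
    ← map_mul, Polynomial.map_mul, hbQ]
  congr 1
  have hb' : (↑u⁻¹ : ℤ_[p]) * b = (p : ℤ_[p]) ^ b.valuation := by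
    conv_lhs => rw [hspec]
    rw [Units.inv_mul_cancel_left]
  rw [Algebra.smul_def, ← mul_assoc, map_C, IsScalarTower.algebraMap_apply ℤ_[p] ℚ_[p] ℚ_[p][X],
    Polynomial.algebraMap_eq, ← C_mul, ← map_mul, hb']
  simp

theorem finrank_generic (hf : f.Monic) :
    Module.finrank ℚ_[p] (AdjoinRoot (f.map (algebraMap ℤ_[p] ℚ_[p]))) = f.natDegree := by
  rw [(AdjoinRoot.powerBasis' (hf.map _)).finrank, AdjoinRoot.powerBasis'_dim,
    hf.natDegree_map]

theorem finite_range_toGeneric (hf : f.Monic) : Module.Finite ℤ_[p] (toGeneric p f).range := by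
  have : Module.Finite ℤ_[p] (AdjoinRoot f) := (AdjoinRoot.powerBasis' hf).finite
  exact Module.Finite.equiv (AlgEquiv.ofInjective _ (toGeneric_injective hf)).toLinearEquiv

theorem finrank_range_toGeneric (hf : f.Monic) :
    Module.finrank ℤ_[p] (toGeneric p f).range =
      Module.finrank ℚ_[p] (AdjoinRoot (f.map (algebraMap ℤ_[p] ℚ_[p]))) := by
  rw [← (AlgEquiv.ofInjective _ (toGeneric_injective hf)).toLinearEquiv.finrank_eq,
    finrank_generic hf, (AdjoinRoot.powerBasis' hf).finrank, AdjoinRoot.powerBasis'_dim]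

theorem isMaximalAt_of_not_memSqMaximal (hf : f.Monic) (h : ¬ MemSqMaximal f) :
    IsMaximalAt p f := by
  have := (AdjoinRoot.powerBasis' (hf.map (algebraMap ℤ_[p] ℚ_[p]))).finite
  have := finite_range_toGeneric hf
  refine ⟨isOrder_of_le (finrank_range_toGeneric hf) le_rfl, fun S hS x hx => ?_⟩
  have := hS.2.1
  have hint : IsIntegral ℤ_[p] x :=
    ((Algebra.IsIntegral.of_finite ℤ_[p] S).isIntegral ⟨x, hx⟩).map S.val
  have hint' : (toGeneric p f).toRingHom.IsIntegralElem x := by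
    obtain ⟨P, hP, hPx⟩ := hint
    refine ⟨P.map (algebraMap _ _), hP.map _, ?_⟩
    rw [eval₂_map, ← hPx]
    congr 1
    exact (toGeneric p f).comp_algebraMap
  exact exists_of_isIntegralElem hf h (toGeneric p f).toRingHom (toGeneric_injective hf)
    (isUnit_natCast_prime _) exists_pow_mul_mem_range hint'

/-- If `f = G² c + p G b + p² a`, then `u = G c / p` is a root of `u² + b u + a c`, so adjoining it
gives a larger order. -/
theorem MemSqMaximal.not_isMaximalAt (hf : f.Monic) (h : MemSqMaximal f) :
    ¬ IsMaximalAt p f := by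
  obtain ⟨G, a, b, c, hG, hirr, hfG⟩ := h
  intro hmax
  have := (AdjoinRoot.powerBasis' (hf.map (algebraMap ℤ_[p] ℚ_[p]))).finite
  have := finite_range_toGeneric hf
  have hpu := isUnit_natCast_prime (p := p) (AdjoinRoot (f.map (algebraMap ℤ_[p] ℚ_[p])))
  set ev : ℤ_[p][X] →+* AdjoinRoot (f.map (algebraMap ℤ_[p] ℚ_[p])) :=
    (toGeneric p f).toRingHom.comp (AdjoinRoot.mk f) with hev
  have hker : ∀ P, ev P = 0 ↔ f ∣ P := fun P => by
    rw [hev, RingHom.comp_apply, map_eq_zero_iff (toGeneric p f).toRingHom (toGeneric_injective hf),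
      AdjoinRoot.mk_eq_zero]
  have hevp : ev (p : ℤ_[p][X]) = p := map_natCast _ _
  obtain ⟨u, hu⟩ : ∃ u, p * u = ev (G * c) := by
    obtain ⟨v, hv⟩ := hpu.exists_right_inv
    exact ⟨v * ev (G * c), by rw [← mul_assoc, hv, one_mul]⟩
  have hquad : u ^ 2 + ev b * u + ev (a * c) = 0 := by
    have h0 : ev f = 0 := (hker f).2 dvd_rfl
    have h0 := (congrArg ev hfG).symm.trans h0
    simp only [map_add, map_mul, map_pow, hevp] at h0 hu ⊢
    refine (hpu.pow 2).mul_left_cancel ?_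
    linear_combination (p * u + ev G * ev c + p * ev b) * hu + ev c * h0
  set R := (toGeneric p f).range with hR
  have hevR : ∀ P, ev P ∈ R := fun P => ⟨AdjoinRoot.mk f P, rfl⟩
  have hintR : IsIntegral R u := by
    refine ⟨X ^ 2 + C ⟨ev b, hevR b⟩ * X + C ⟨ev (a * c), hevR _⟩, ?_, ?_⟩
    · monicity!
    · rw [← hquad]
      simp
  have : Algebra.IsIntegral ℤ_[p] R := Algebra.IsIntegral.of_finite _ _
  have hint : IsIntegral ℤ_[p] u := isIntegral_trans (A := R) u hintR
  have : Module.Finite ℤ_[p] (Algebra.adjoin ℤ_[p] {u}) :=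
    ⟨(Submodule.fg_top _).2 hint.fg_adjoin_singleton⟩
  have := Subalgebra.finite_sup R (Algebra.adjoin ℤ_[p] {u})
  have hle := hmax.2 (isOrder_of_le (finrank_range_toGeneric hf)
    (le_sup_left : R ≤ R ⊔ Algebra.adjoin ℤ_[p] {u}))
  obtain ⟨r, hr⟩ : u ∈ R :=
    hle ((le_sup_right : Algebra.adjoin ℤ_[p] {u} ≤ R ⊔ _) (Algebra.self_mem_adjoin_singleton _ u))
  obtain ⟨Q, rfl⟩ := AdjoinRoot.mk_surjective r
  replace hr : ev Q = u := hr
  -- If `u` were in `R`, then modulo `p` one would have `G c = f W = G² c W`, and cancelling `G c`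
  -- would make `G` a unit.
  obtain ⟨W, hW⟩ : f ∣ G * c - p * Q := by
    rw [← hker, map_sub, ← hu, map_mul, hevp, hr, sub_self]
  have h1 := congrArg (red p) hW
  have h2 := congrArg (red p) hfG
  simp only [map_sub, map_add, map_mul, map_pow, red_natCast_self, zero_mul, sub_zero, add_zero,
    ne_eq, OfNat.ofNat_ne_zero, not_false_eq_true, zero_pow] at h1 h2
  have hc : red p c ≠ 0 := by
    intro hc
    rw [hc, mul_zero] at h2
    exact (hf.map PadicInt.toZMod).ne_zero h2
  refine hirr.not_isUnit (.of_mul_eq_one (red p W) (mul_left_cancel₀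
    (mul_ne_zero hirr.ne_zero hc) ?_))
  rw [h2] at h1
  linear_combination -h1

theorem isMaximalAt_iff (hf : f.Monic) : IsMaximalAt p f ↔ ¬ MemSqMaximal f :=
  ⟨fun h h' => h'.not_isMaximalAt hf h, isMaximalAt_of_not_memSqMaximal hf⟩

end Orders

/-! ### Residues modulo `p²` as pairs over `ZMod p` -/

section Residues

/-- Extracting common squares against `h = 0` leaves a squarefree `t`. -/
theorem exists_sq_mul {F : Type*} [Field F] {f : F[X]} (hf : f.Monic) :
    ∃ s t : F[X], s.Monic ∧ t.Monic ∧ f = s ^ 2 * t ∧ ∀ g, Irreducible g → g ^ 2 ∣ f → g ∣ s := by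
  obtain ⟨s, t, h₀, hs, ht, hst, hsh, hsq⟩ := exists_mul_noCommonSquare (h := 0) hf
  refine ⟨s, t, hs, ht, hst, fun g hg hgf => ?_⟩
  by_contra hgs
  rw [hst] at hgf
  have hcop : IsCoprime (g ^ 2) (s ^ 2) := ((hg.coprime_iff_not_dvd).2 hgs).pow
  have h0 : h₀ = 0 := (mul_eq_zero.1 hsh.symm).resolve_left hs.ne_zero
  exact hg.not_isUnit (hsq g (hcop.dvd_of_dvd_mul_left hgf) (h0 ▸ dvd_zero g))

variable {p : ℕ} [Fact p.Prime]

/-- With `f = s² t` and `t` squarefree, the lift is `S² T`. If `g² ∣ f` then `g ∣ s`, so `S ∈ (p,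
G)` and `S² T ∈ (p, G)²`; only `p H` then decides, and it lies in `(p, G)²` iff `g ∣ H̄`. -/
theorem exists_lift_memSqMaximal_iff {f : (ZMod p)[X]} (hf : f.Monic) :
    ∃ σ : ℤ_[p][X], σ.Monic ∧ σ.natDegree = f.natDegree ∧ red p σ = f ∧
      ∀ H : ℤ_[p][X], MemSqMaximal (σ + (p : ℤ_[p][X]) * H) ↔ ¬ NoCommonSquare f (red p H) := by
  obtain ⟨s, t, hs, ht, rfl, hst⟩ := exists_sq_mul hf
  obtain ⟨S, rfl, hS, hSm⟩ := exists_monic_lift hs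
  obtain ⟨T, rfl, hT, hTm⟩ := exists_monic_lift ht
  refine ⟨S ^ 2 * T, (hSm.pow 2).mul hTm, ?_, by simp, fun H => ⟨?_, fun h => ?_⟩⟩
  · rw [(hSm.pow 2).natDegree_mul hTm, hSm.natDegree_pow, (hs.pow 2).natDegree_mul ht,
      hs.natDegree_pow, hS, hT]
  · rintro ⟨G, a, b, c, hG, hirr, hfG⟩ hgood
    have h1 := congrArg (red p) hfG
    simp only [map_add, map_mul, map_pow, red_natCast_self, zero_mul, add_zero, ne_eq,
      OfNat.ofNat_ne_zero, not_false_eq_true, zero_pow] at h1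
    have hdvd : red p G ^ 2 ∣ red p S ^ 2 * red p T := ⟨_, h1⟩
    obtain ⟨U, V, hUV⟩ := exists_eq_of_red_dvd (hst _ hirr hdvd)
    have h2 : (p : ℤ_[p][X]) * H = G ^ 2 * (c - U ^ 2 * T) + p * (G * (b - 2 * U * V * T)
        + p * (a - V ^ 2 * T)) := by
      rw [hUV] at hfG
      linear_combination hfG
    -- Modulo `p` the left side of `h2` vanishes, so its `G²` coefficient is divisible by `p`; one
    -- factor `p` then cancels.
    obtain ⟨c', hc'⟩ := exists_eq_of_red_eq_zero (P := c - U ^ 2 * T) (by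
      have h3 := congrArg (red p) h2
      rw [map_add, map_mul, map_mul, map_mul, red_natCast_self, zero_mul, zero_mul, add_zero,
        map_pow] at h3
      exact (mul_eq_zero.1 h3.symm).resolve_left (pow_ne_zero 2 hirr.ne_zero))
    have h4 : H = G * (G * c' + (b - 2 * U * V * T)) + p * (a - V ^ 2 * T) := by
      refine mul_left_cancel₀ natCast_self_ne_zero ?_
      rw [h2, hc']
      ring
    refine hirr.not_isUnit (hgood _ hdvd ?_)
    rw [h4, map_add, map_mul, map_mul, red_natCast_self, zero_mul, add_zero]
    exact dvd_mul_right _ _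
  · simp only [NoCommonSquare, not_forall] at h
    obtain ⟨g, hgf, hgh, hgu⟩ := h
    have hg0 : g ≠ 0 := by
      rintro rfl
      exact hf.ne_zero (by simpa using hgf)
    obtain ⟨g', hm, hirr, hg'⟩ := exists_monic_irreducible_factor g hgu
    obtain ⟨G, rfl, -, hGm⟩ := exists_monic_lift hm
    obtain ⟨U, V, hUV⟩ := exists_eq_of_red_dvd
      (hst _ hirr ((pow_dvd_pow_of_dvd hg' 2).trans hgf))
    obtain ⟨W, Z, hWZ⟩ := exists_eq_of_red_dvd (hg'.trans hgh)
    exact ⟨G, V ^ 2 * T + Z, 2 * U * V * T + W, U ^ 2 * T, hGm, hirr, by rw [hUV, hWZ]; ring⟩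

variable {n : ℕ}

theorem toZModPow_eq_iff {x y : ℤ_[p]} :
    PadicInt.toZModPow 2 x = PadicInt.toZModPow 2 y ↔ (p : ℤ_[p]) ^ 2 ∣ x - y := by
  rw [← sub_eq_zero, ← map_sub, ← RingHom.mem_ker, PadicInt.ker_toZModPow,
    Ideal.mem_span_singleton]

theorem toZMod_eq_zero_iff {x : ℤ_[p]} : PadicInt.toZMod x = 0 ↔ (p : ℤ_[p]) ∣ x := by
  rw [← RingHom.mem_ker, PadicInt.ker_toZMod, PadicInt.maximalIdeal_eq_span_p,
    Ideal.mem_span_singleton]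

/-- Reduction of coefficient vectors modulo `p ^ 2`. -/
noncomputable def residue (p : ℕ) [Fact p.Prime] (n : ℕ) :
    (Fin n → ℤ_[p]) →+ (Fin n → ZMod (p ^ 2)) :=
  (PadicInt.toZModPow 2 : ℤ_[p] →+* ZMod (p ^ 2)).toAddMonoidHom.compLeft (Fin n)

theorem residue_apply (a : Fin n → ℤ_[p]) (i : Fin n) :
    residue p n a i = PadicInt.toZModPow 2 (a i) := rfl

theorem residue_surjective : Function.Surjective (residue p n) := fun x =>
  ⟨fun i => (ZMod.ringHom_surjective (PadicInt.toZModPow (p := p) 2) (x i)).choose,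
    funext fun i => (ZMod.ringHom_surjective (PadicInt.toZModPow (p := p) 2) (x i)).choose_spec⟩

/-- The residues modulo `p ^ 2` of the coefficient vectors in `maximalSet p n`. -/
def maximalResidues (p : ℕ) [Fact p.Prime] (n : ℕ) : Set (Fin n → ZMod (p ^ 2)) :=
  residue p n '' maximalSet p n

theorem mem_maximalSet_iff {a : Fin n → ℤ_[p]} :
    a ∈ maximalSet p n ↔ ¬ MemSqMaximal (monicOfCoeffs a) :=
  isMaximalAt_iff (monicOfCoeffs_monic a)

theorem MemSqMaximal.of_residue_eq {a b : Fin n → ℤ_[p]} (h : residue p n a = residue p n b)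
    (ha : MemSqMaximal (monicOfCoeffs a)) : MemSqMaximal (monicOfCoeffs b) := by
  have hi : ∀ i, (p : ℤ_[p]) ^ 2 ∣ b i - a i := fun i =>
    toZModPow_eq_iff.1 (congrFun h i).symm
  choose e he using hi
  convert ha.add (∑ i : Fin n, C (e i) * X ^ (i : ℕ)) using 1
  rw [monicOfCoeffs, monicOfCoeffs, add_assoc, Finset.mul_sum, ← Finset.sum_add_distrib]
  congr 1
  refine Finset.sum_congr rfl fun i _ => ?_
  rw [show b i = a i + (p : ℤ_[p]) ^ 2 * e i by linear_combination he i]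
  simp only [map_add, map_mul, map_pow, map_natCast]
  ring

theorem residue_mem_maximalResidues {a : Fin n → ℤ_[p]} :
    residue p n a ∈ maximalResidues p n ↔ a ∈ maximalSet p n := by
  refine ⟨?_, Set.mem_image_of_mem _⟩
  rintro ⟨b, hb, hba⟩
  rw [mem_maximalSet_iff] at *
  exact fun h => hb (h.of_residue_eq hba.symm)

theorem sum_fin_coeff {R : Type*} [CommRing R] {h : R[X]} (hh : h ∈ degreeLT R n) :
    ∑ i : Fin n, C (h.coeff i) * X ^ (i : ℕ) = h := by
  ext k
  rw [finsetSum_coeff]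
  by_cases hk : k < n
  · exact (Fintype.sum_eq_single (⟨k, hk⟩ : Fin n) (fun j hj => by
      rw [coeff_C_mul_X_pow, if_neg (fun h => hj (Fin.ext h.symm))])).trans (by simp)
  · rw [Finset.sum_eq_zero fun j _ => by rw [coeff_C_mul_X_pow, if_neg (by omega)]]
    rw [mem_degreeLT] at hh
    exact (coeff_eq_zero_of_degree_lt (hh.trans_le (by exact_mod_cast not_lt.1 hk))).symm

/-- The pair `(f, h)` names the class of `σ f + p h`, a first and second `p`-adic digit. Injectivity
is read off one digit at a time, and equal cardinalities give surjectivity. -/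
theorem exists_residue_param (p : ℕ) [Fact p.Prime] (n : ℕ) :
    ∃ Ψ : (monicsOfDegree (ZMod p) n × degreeLT (ZMod p) n) ≃ (Fin n → ZMod (p ^ 2)),
      ∀ x, Ψ x ∈ maximalResidues p n ↔ NoCommonSquare x.1.1 x.2.1 := by
  choose σ hσm hσd hσr hσ using
    fun f : monicsOfDegree (ZMod p) n => exists_lift_memSqMaximal_iff f.2.1
  choose ℓ hℓ using toZMod_surjective (p := p)
  let a : monicsOfDegree (ZMod p) n × degreeLT (ZMod p) n → Fin n → ℤ_[p] :=
    fun x i => (σ x.1).coeff i + p * ℓ (x.2.1.coeff i)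
  have ha : ∀ x, monicOfCoeffs (a x) =
      σ x.1 + (p : ℤ_[p][X]) * ∑ i : Fin n, C (ℓ (x.2.1.coeff i)) * X ^ (i : ℕ) := by
    intro x
    conv_rhs => rw [← monicOfCoeffs_coeff (hσm x.1) ((hσd x.1).trans x.1.2.2)]
    rw [monicOfCoeffs, monicOfCoeffs, add_assoc, Finset.mul_sum, ← Finset.sum_add_distrib]
    congr 1
    refine Finset.sum_congr rfl fun i _ => ?_
    simp only [a, map_add, map_mul, map_natCast]
    ring
  have hred : ∀ h ∈ degreeLT (ZMod p) n,
      red p (∑ i : Fin n, C (ℓ (h.coeff i)) * X ^ (i : ℕ)) = h := by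
    intro h hh
    conv_rhs => rw [← sum_fin_coeff hh]
    simp [hℓ]
  have hinj : Function.Injective fun x => residue p n (a x) := by
    rintro ⟨f, h⟩ ⟨f', h'⟩ hx
    have hdvd : ∀ i, (p : ℤ_[p]) ^ 2 ∣ a (f, h) i - a (f', h') i := fun i =>
      toZModPow_eq_iff.1 (congrFun hx i)
    obtain rfl : f = f' := by
      refine Subtype.ext ?_
      rw [← monicOfCoeffs_coeff f.2.1 f.2.2, ← monicOfCoeffs_coeff f'.2.1 f'.2.2]
      congr 1
      ext i
      have h1 : PadicInt.toZMod (a (f, h) i - a (f', h') i) = 0 :=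
        toZMod_eq_zero_iff.2 ((dvd_pow_self _ two_ne_zero).trans (hdvd i))
      simp only [a, map_sub, map_add, map_mul, map_natCast, CharP.cast_eq_zero, zero_mul,
        add_zero, sub_eq_zero] at h1
      rwa [← coeff_map, ← coeff_map, ← coe_mapRingHom, hσr, hσr] at h1
    refine Prod.ext rfl (Subtype.ext ?_)
    rw [← sum_fin_coeff h.2, ← sum_fin_coeff h'.2]
    refine Finset.sum_congr rfl fun i _ => ?_
    have hp0 : (p : ℤ_[p]) ≠ 0 := Nat.cast_ne_zero.2 (Fact.out : p.Prime).ne_zero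
    have h1 : (p : ℤ_[p]) ∣ ℓ (h.1.coeff i) - ℓ (h'.1.coeff i) := by
      refine (mul_dvd_mul_iff_left hp0).1 ?_
      convert hdvd i using 1
      · ring
      · simp only [a]
        ring
    have h2 := toZMod_eq_zero_iff.2 h1
    rw [map_sub, hℓ, hℓ, sub_eq_zero] at h2
    rw [h2]
  have hbij : Function.Bijective fun x => residue p n (a x) := by
    rw [Nat.bijective_iff_injective_and_card]
    refine ⟨hinj, ?_⟩
    rw [Nat.card_prod, card_monicsOfDegree, card_degreeLT, Nat.card_fun, Nat.card_zmod,
      Nat.card_zmod, Nat.card_fin]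
    ring
  refine ⟨Equiv.ofBijective _ hbij, fun x => ?_⟩
  rw [Equiv.ofBijective_apply, residue_mem_maximalResidues, mem_maximalSet_iff, ha, hσ, not_not,
    hred _ x.2.2]

theorem card_maximalResidues (hn : 2 ≤ n) :
    Nat.card (maximalResidues p n) + p ^ (2 * n - 2) = p ^ (2 * n) := by
  obtain ⟨Ψ, hΨ⟩ := exists_residue_param p n
  have h := card_goodPairs (F := ZMod p) hn
  rw [Nat.card_zmod] at h
  rw [← h]
  congr 1
  let e : {x // NoCommonSquare (x : monicsOfDegree (ZMod p) n × degreeLT (ZMod p) n).1.1 x.2.1} ≃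
      maximalResidues p n := Ψ.subtypeEquiv fun x => (hΨ x).symm
  rw [← Nat.card_congr e]
  exact Nat.card_congr
    { toFun := fun x => ⟨(x.1.1.1, x.1.2.1), x.1.1.2, x.1.2.2, x.2⟩
      invFun := fun x => ⟨(⟨x.1.1, x.2.1⟩, ⟨x.1.2, x.2.2.1⟩), x.2.2.2⟩
      left_inv := fun _ => rfl
      right_inv := fun _ => rfl }

end Residues

/-! ### Haar measure of residue conditions -/

section Haar

variable {p : ℕ} [Fact p.Prime] {n : ℕ}

instance isAddLeftInvariant_coeffHaar : (coeffHaar p n).IsAddLeftInvariant := by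
  unfold coeffHaar
  infer_instance

instance isProbabilityMeasure_coeffHaar : IsProbabilityMeasure (coeffHaar p n) :=
  ⟨Measure.addHaarMeasure_self⟩

theorem isClosed_residue_preimage (x : Fin n → ZMod (p ^ 2)) :
    IsClosed (residue p n ⁻¹' {x}) := by
  obtain ⟨a, rfl⟩ := residue_surjective x
  have : residue p n ⁻¹' {residue p n a} =
      ⋂ i, {b : Fin n → ℤ_[p] | ‖b i - a i‖ ≤ (p : ℝ) ^ (-(2 : ℕ) : ℤ)} := by
    ext b
    simp only [Set.mem_preimage, Set.mem_singleton_iff, Set.mem_iInter, Set.mem_ofPred_eq,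
      PadicInt.norm_le_pow_iff_mem_span_pow, Ideal.mem_span_singleton, ← toZModPow_eq_iff]
    exact funext_iff
  rw [this]
  exact isClosed_iInter fun i => isClosed_le (by fun_prop) continuous_const

theorem measurableSet_residue_preimage (X : Set (Fin n → ZMod (p ^ 2))) :
    MeasurableSet (residue p n ⁻¹' X) := by
  rw [← Set.biUnion_preimage_singleton]
  exact X.toFinite.measurableSet_biUnion fun x _ => (isClosed_residue_preimage x).measurableSet

/-- The fibres of reduction are translates of one another, so they share the total mass `1` equally.
-/
theorem measure_residue_preimage (X : Set (Fin n → ZMod (p ^ 2))) :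
    (coeffHaar p n).real (residue p n ⁻¹' X) = Nat.card X / ((p : ℝ) ^ 2) ^ n := by
  classical
  have hfib : ∀ x, (coeffHaar p n).real (residue p n ⁻¹' {x}) =
      (coeffHaar p n).real (residue p n ⁻¹' {0}) := by
    intro x
    obtain ⟨a, rfl⟩ := residue_surjective x
    rw [measureReal_def, measureReal_def,
      ← measure_preimage_add (coeffHaar p n) a (residue p n ⁻¹' {residue p n a})]
    congr 2
    ext b
    simp
  have hsum : ∀ X : Set (Fin n → ZMod (p ^ 2)), (coeffHaar p n).real (residue p n ⁻¹' X) =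
      Nat.card X * (coeffHaar p n).real (residue p n ⁻¹' {0}) := by
    intro X
    have := Fintype.ofFinite X
    rw [← Set.biUnion_preimage_singleton, ← Set.coe_toFinset X]
    simp only [Finset.mem_coe]
    rw [measureReal_biUnion_finset]
    · rw [Finset.sum_congr rfl fun x _ => hfib x, Finset.sum_const, nsmul_eq_mul]
      simp
    · intro x _ y _ hxy
      exact Disjoint.preimage _ (by simpa using hxy)
    · exact fun x _ => (isClosed_residue_preimage x).measurableSet
  have h1 := hsum Set.univ
  rw [Set.preimage_univ, probReal_univ, Nat.card_univ, Nat.card_fun, Nat.card_zmod,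
    Nat.card_fin] at h1
  push_cast at h1
  have hp0 : (p : ℝ) ≠ 0 := Nat.cast_ne_zero.2 (Fact.out : p.Prime).ne_zero
  rw [hsum, eq_div_iff (by positivity), mul_assoc, mul_comm _ (((p : ℝ) ^ 2) ^ n), ← h1, mul_one]

end Haar

/-! ### Residue conditions in boxes of integer polynomials -/

section Box

/-- The integers in `[-H, H]` whose residue modulo `q` is `v`. -/
noncomputable def boxClass {q : ℕ} (v : ZMod q) (H : ℕ) : Finset ℤ :=
  (Finset.Icc (-(H : ℤ)) H).filter fun k : ℤ => (k : ZMod q) = v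

/-- Each residue class modulo `q` has density `1 / q` in the intervals `[-H, H]`. -/
theorem tendsto_card_residue_class {q : ℕ} (hq : 0 < q) (v : ZMod q) :
    Tendsto (fun H : ℕ => (((boxClass v H).card : ℕ) : ℝ) /
      (2 * H + 1 : ℝ)) atTop (𝓝 ((q : ℝ)⁻¹)) := by
  obtain ⟨w, rfl⟩ := ZMod.intCast_surjective v
  have hq' : (0 : ℝ) < q := by exact_mod_cast hq
  have hbound : ∀ H : ℕ, |(((boxClass (w : ZMod q) H).card : ℕ) : ℝ) /
      (2 * H + 1 : ℝ) - (q : ℝ)⁻¹| ≤ 1 / (2 * H + 1 : ℝ) := by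
    intro H
    -- The floor formula counts in half-open intervals, hence the left end `-H - 1`.
    have hset : (boxClass (w : ZMod q) H) =
        {k ∈ Finset.Ioc (-(H : ℤ) - 1) H | k ≡ w [ZMOD (q : ℤ)]} := by
      ext k
      simp only [boxClass, Finset.mem_filter, Finset.mem_Icc, Finset.mem_Ioc, ZMod.intCast_eq_intCast_iff]
      exact and_congr_left fun _ => by omega
    have hcard := Int.Ioc_filter_modEq_card (-(H : ℤ) - 1) H (r := q) (by exact_mod_cast hq) w
    rw [← hset] at hcard
    set c := (boxClass (w : ZMod q) H).card
    push_cast at hcard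
    have hle : ⌊((-(H : ℚ) - 1) - w) / q⌋ ≤ ⌊((H : ℚ) - w) / q⌋ := by
      have : (0 : ℚ) ≤ H := by positivity
      exact Int.floor_le_floor (by gcongr; linarith)
    rw [max_eq_left (by omega)] at hcard
    have hcQ : (c : ℚ) = (⌊((H : ℚ) - w) / q⌋ : ℚ) - ⌊((-(H : ℚ) - 1) - w) / q⌋ := by
      exact_mod_cast hcard
    have e1 := Int.floor_le (((H : ℚ) - w) / q)
    have e2 := Int.lt_floor_add_one (((H : ℚ) - w) / q)
    have e3 := Int.floor_le (((-(H : ℚ) - 1) - w) / q)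
    have e4 := Int.lt_floor_add_one (((-(H : ℚ) - 1) - w) / q)
    have e5 : ((H : ℚ) - w) / q - ((-(H : ℚ) - 1) - w) / q = (2 * H + 1) / q := by ring
    have hQ : |(c : ℚ) - (2 * H + 1) / q| ≤ 1 := by
      rw [abs_le]
      constructor <;> linarith
    have hR : |(c : ℝ) - (2 * H + 1) / q| ≤ 1 := by
      have := (Rat.cast_le (K := ℝ)).2 hQ
      push_cast at this
      exact this
    have hpos : (0 : ℝ) < 2 * H + 1 := by positivity
    rw [show (c : ℝ) / (2 * H + 1) - (q : ℝ)⁻¹ = (c - (2 * H + 1) / q) / (2 * H + 1) by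
      field_simp, abs_div, abs_of_pos hpos]
    gcongr
  have hlim : Tendsto (fun H : ℕ => 1 / (2 * H + 1 : ℝ)) atTop (𝓝 0) := by
    refine tendsto_const_nhds.div_atTop (tendsto_atTop_add_const_right _ _ ?_)
    exact tendsto_natCast_atTop_atTop.const_mul_atTop two_pos
  rw [tendsto_iff_dist_tendsto_zero]
  exact squeeze_zero (fun _ => dist_nonneg) hbound hlim

/-- The integer coefficient vectors with entries in `[-H, H]`. -/
noncomputable def coeffBox (n H : ℕ) : Finset (Fin n → ℤ) := Fintype.piFinset fun _ => Finset.Icc (-(H : ℤ)) H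

theorem card_coeffBox (n H : ℕ) : (coeffBox n H).card = (2 * H + 1) ^ n := by
  rw [coeffBox, Fintype.card_piFinset_const, Int.card_Icc]
  congr 1
  omega

theorem height_le_iff {f : ℤ[X]} {H : ℕ} : height f ≤ H ↔ ∀ i, (f.coeff i).natAbs ≤ H := by
  rw [height, Finset.sup_le_iff]
  refine ⟨fun h i => ?_, fun h i _ => h i⟩
  by_cases hi : i ∈ f.support
  · exact h i hi
  · simp [notMem_support_iff.1 hi]

/-- The leading coefficient `1` counts towards the height, so `H = 0` must be excluded. -/
theorem height_monicOfCoeffs_le_iff {n H : ℕ} (hH : 1 ≤ H) (z : Fin n → ℤ) :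
    height (monicOfCoeffs z) ≤ H ↔ z ∈ coeffBox n H := by
  simp only [height_le_iff, coeffBox, Fintype.mem_piFinset, Finset.mem_Icc]
  refine ⟨fun h i => ?_, fun h i => ?_⟩
  · have := h i
    rw [coeff_monicOfCoeffs] at this
    omega
  · rcases lt_trichotomy i n with hi | rfl | hi
    · have h1 := h ⟨i, hi⟩
      have h2 := coeff_monicOfCoeffs z ⟨i, hi⟩
      dsimp only at h2
      omega
    · have h1 := (monicOfCoeffs_monic z).coeff_natDegree
      rw [natDegree_monicOfCoeffs] at h1
      rw [h1]
      simpa using hH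
    · rw [coeff_eq_zero_of_natDegree_lt (by rwa [natDegree_monicOfCoeffs])]
      simp

open Classical in
theorem ncard_heightBox_filter {n H : ℕ} (hH : 1 ≤ H) (P : ℤ[X] → Prop) :
    {f ∈ heightBox n H | P f}.ncard =
      ((coeffBox n H).filter fun z => P (monicOfCoeffs z)).card := by
  have : {f ∈ heightBox n H | P f} =
      monicOfCoeffs '' (((coeffBox n H).filter fun z => P (monicOfCoeffs z) : Finset (Fin n → ℤ)) :
        Set (Fin n → ℤ)) := by
    ext f
    simp only [Finset.coe_filter, Set.mem_image, Set.mem_ofPred_eq, heightBox]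
    constructor
    · rintro ⟨⟨hf, hn, hfH⟩, hP⟩
      have h := monicOfCoeffs_coeff hf hn
      exact ⟨_, ⟨(height_monicOfCoeffs_le_iff hH _).1 (h.symm ▸ hfH), h.symm ▸ hP⟩, h⟩
    · rintro ⟨z, ⟨hz, hP⟩, rfl⟩
      exact ⟨⟨monicOfCoeffs_monic z, natDegree_monicOfCoeffs z,
        (height_monicOfCoeffs_le_iff hH z).2 hz⟩, hP⟩
  rw [this, Set.ncard_image_of_injective _ monicOfCoeffs_injective, Set.ncard_coe_finset]

open Classical in
theorem card_coeffBox_filter {q n H : ℕ} (X : Finset (Fin n → ZMod q)) :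
    {z ∈ coeffBox n H | (fun i => (z i : ZMod q)) ∈ X}.card =
      ∑ x ∈ X, ∏ i, (boxClass (x i) H).card := by
  refine (Finset.card_eq_sum_card_fiberwise
    (s := (coeffBox n H).filter fun z => (fun i => (z i : ZMod q)) ∈ X)
    (f := fun (z : Fin n → ℤ) i => (z i : ZMod q)) (t := X)
    (fun z hz => (Finset.mem_filter.1 hz).2)).trans ?_
  refine Finset.sum_congr rfl fun x hx => ?_
  rw [← Fintype.card_piFinset]
  congr 1
  ext z
  simp only [Finset.mem_filter, coeffBox, boxClass, Fintype.mem_piFinset, funext_iff]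
  constructor
  · exact fun h i => ⟨h.1.1 i, h.2 i⟩
  · intro h
    have e : (fun i => (z i : ZMod q)) = x := funext fun i => (h i).2
    exact ⟨⟨fun i => (h i).1, e ▸ hx⟩, fun i => (h i).2⟩

theorem hasHeightDensity_of_residues {q n : ℕ} (hq : 0 < q) (X : Set (Fin n → ZMod q))
    (P : ℤ[X] → Prop)
    (hP : ∀ z : Fin n → ℤ, P (monicOfCoeffs z) ↔ (fun i => (z i : ZMod q)) ∈ X) :
    HasHeightDensity n P (Nat.card X / (q : ℝ) ^ n) := by
  classical
  have : NeZero q := ⟨hq.ne'⟩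
  have := Fintype.ofFinite X
  have hlim : Tendsto (fun H : ℕ => ∑ x ∈ X.toFinset, ∏ i,
      (((boxClass (x i) H).card : ℕ) : ℝ) / (2 * H + 1 : ℝ))
      atTop (𝓝 (∑ x ∈ X.toFinset, ∏ _i : Fin n, (q : ℝ)⁻¹)) :=
    tendsto_finsetSum _ fun x _ => tendsto_finsetProd _ fun i _ =>
      tendsto_card_residue_class hq (x i)
  have hval : ∑ x ∈ X.toFinset, ∏ _i : Fin n, (q : ℝ)⁻¹ = Nat.card X / (q : ℝ) ^ n := by
    simp [div_eq_mul_inv]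
  rw [hval] at hlim
  refine hlim.congr' ?_
  filter_upwards [eventually_ge_atTop 1] with H hH
  have htot : (heightBox n H).ncard = (2 * H + 1) ^ n := by
    have := ncard_heightBox_filter (n := n) hH (fun _ => True)
    simpa [card_coeffBox] using this
  rw [ncard_heightBox_filter hH, htot]
  simp only [hP]
  have := card_coeffBox_filter (H := H) X.toFinset
  simp only [Set.mem_toFinset] at this
  rw [this]
  push_cast
  rw [Finset.sum_div]
  refine Finset.sum_congr rfl fun x _ => ?_
  simp [Finset.prod_div_distrib]

end Box

/-! ### The two densities and their limit -/

section Density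

variable {p : ℕ} [Fact p.Prime] {n : ℕ}

theorem card_maximalResidues_div (hn : 2 ≤ n) :
    (Nat.card (maximalResidues p n) : ℝ) / ((p : ℝ) ^ 2) ^ n = 1 - ((p : ℝ) ^ 2)⁻¹ := by
  have hp0 : (p : ℝ) ≠ 0 := Nat.cast_ne_zero.2 (Fact.out : p.Prime).ne_zero
  obtain ⟨m, rfl⟩ := Nat.exists_eq_add_of_le' hn
  have h : (Nat.card (maximalResidues p (m + 2)) : ℝ) + (p : ℝ) ^ (2 * m + 2) =
      (p : ℝ) ^ (2 * (m + 2)) := by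
    exact_mod_cast card_maximalResidues (p := p) hn
  rw [eq_sub_of_add_eq h]
  field_simp
  ring

theorem preimage_maximalResidues :
    residue p n ⁻¹' maximalResidues p n = maximalSet p n :=
  Set.ext fun _ => residue_mem_maximalResidues

theorem hasPadicDensity_maximalSet (hn : 2 ≤ n) :
    HasPadicDensity p (maximalSet p n) (1 - ((p : ℝ) ^ 2)⁻¹) := by
  rw [← preimage_maximalResidues]
  exact ⟨measurableSet_residue_preimage _, by
    rw [measure_residue_preimage, card_maximalResidues_div hn]⟩

theorem hasHeightDensity_isMaximalAt (hn : 2 ≤ n) :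
    HasHeightDensity n (fun f => IsMaximalAt p (f.map (Int.castRingHom ℤ_[p])))
      (1 - ((p : ℝ) ^ 2)⁻¹) := by
  rw [← card_maximalResidues_div hn, ← Nat.cast_pow p 2]
  refine hasHeightDensity_of_residues (pow_pos (Fact.out : p.Prime).pos 2) _ _ fun z => ?_
  rw [map_monicOfCoeffs]
  refine residue_mem_maximalResidues.symm.trans (iff_of_eq ?_)
  congr 1
  ext i
  simp [residue_apply]

end Density

theorem tendsto_density :
    Tendsto (fun p : Nat.Primes => 1 - (((p : ℕ) : ℝ) ^ 2)⁻¹) primesAtTop (𝓝 1) := by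
  have h : Tendsto (fun p : Nat.Primes => ((p : ℕ) : ℝ)) primesAtTop atTop :=
    tendsto_natCast_atTop_atTop.comp tendsto_comap
  simpa using ((tendsto_inv_atTop_zero.comp
    ((tendsto_pow_atTop two_ne_zero).comp h)).const_sub (1 : ℝ))

end PadicMaximalOrder

/-- For every prime `p` and degree `n ≥ 2`, the density of the monic `f` of degree `n` such that
`ℤ_p[x]/(f)` is the maximal order of `ℚ_p[x]/(f)` exists and equals `1 - p⁻²`, both for all `f`
over `ℤ_p` (Haar measure) and for integral `f` ordered by height. If the degree `d p` is at least
`2` for all large primes `p` (a constant `n ≥ 2`, `p ^ (2 * ℓ)`, or `(p - 1) ^ (2 * ℓ)`, say), then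
these densities tend to `1` as `p → ∞`. -/
theorem corollary10p6 :
    (∀ (p : ℕ) [Fact p.Prime] (n : ℕ), 2 ≤ n →
      PadicMaximalOrder.HasPadicDensity p (PadicMaximalOrder.maximalSet p n)
        (1 - ((p : ℝ) ^ 2)⁻¹) ∧
      PadicMaximalOrder.HasHeightDensity n
        (fun f => PadicMaximalOrder.IsMaximalAt p (f.map (Int.castRingHom ℤ_[p])))
        (1 - ((p : ℝ) ^ 2)⁻¹)) ∧
    (∀ d : Nat.Primes → ℕ, (∀ᶠ p : Nat.Primes in PadicMaximalOrder.primesAtTop, 2 ≤ d p) →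
      Tendsto (fun p : Nat.Primes => (PadicMaximalOrder.coeffHaar (p : ℕ) (d p)).real
        (PadicMaximalOrder.maximalSet (p : ℕ) (d p)))
        PadicMaximalOrder.primesAtTop (𝓝 1) ∧
      ∀ δ : Nat.Primes → ℝ,
        (∀ᶠ p : Nat.Primes in PadicMaximalOrder.primesAtTop,
          PadicMaximalOrder.HasHeightDensity (d p)
          (fun f => PadicMaximalOrder.IsMaximalAt (p : ℕ) (f.map (Int.castRingHom ℤ_[p])))
          (δ p)) →
        Tendsto δ PadicMaximalOrder.primesAtTop (𝓝 1)) := by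
  refine ⟨fun p _ n hn => ⟨PadicMaximalOrder.hasPadicDensity_maximalSet hn,
    PadicMaximalOrder.hasHeightDensity_isMaximalAt hn⟩, fun d hd => ⟨?_, fun δ hδ => ?_⟩⟩
  · refine PadicMaximalOrder.tendsto_density.congr' ?_
    filter_upwards [hd] with p hp
    exact (PadicMaximalOrder.hasPadicDensity_maximalSet hp).2.symm
  · refine PadicMaximalOrder.tendsto_density.congr' ?_
    filter_upwards [hd, hδ] with p hp hδp
    exact tendsto_nhds_unique (PadicMaximalOrder.hasHeightDensity_isMaximalAt hp) hδp
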